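/- Let $H$ be a separable complex Hilbert space and let $\alpha:\mathcal B(H)\to\mathcal B(H)$ be a non-zero $*$-endomorphism (not necessarily unital). A \emph{transfer operator} for $(\mathcal B(H),\alpha)$ is a continuous positive linear map $\mathcal L:\mathcal B(H)\to\mathcal B(H)$ with $\mathcal L(\alpha(a)b)=a\mathcal L(b)$ for all $a,b\in\mathcal B(H)$. It is \emph{normal} if it preserves the suprema of bounded increasing nets of self-adjoint operators, and \emph{non-degenerate} if the following equivalent conditions hold: $\alpha\circ\mathcal L$ is a conditional expectation onto $\alpha(\mathcal B(H))$; $\alpha\circ\mathcal L\circ\alpha=\alpha$; $\alpha(\mathcal L(1))=\alpha(1)$. There are a number $n\in\{1,2,\dots,\infty\}$ and isometries $U_i\in\mathcal B(H)$, $i=1,\dots,n$ ($i\in\mathbb N$ if $n=\infty$), with pairwise orthogonal ranges, such that $$\alpha(a)=\sum_{i=1}^nU_iaU_i^*,\qquad a\in\mathcal B(H),$$ where the sum converges in the weak operator topology. For any such $n$ and $(U_i)_{i=1}^n$ the following holds. Let $H_n$ be the Hilbert space $\ell^2(\{1,\dots,n\})$ (that is, $\ell^2(\mathbb N)$ if $n=\infty$)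 with its standard orthonormal basis $(e_i)$, and for an operator $\rho$ on $H_n$ put $\rho(i,j)=\langle\rho e_j,e_i\rangle$. (1) A linear map $\mathcal L:\mathcal B(H)\to\mathcal B(H)$ is a normal transfer operator for $(\mathcal B(H),\alpha)$ if and only if there is a positive trace class operator $\rho$ on $H_n$ such that $$\mathcal L(a)=\sum_{i,j=1}^n\rho(i,j)\,U_i^*aU_j,\qquad a\in\mathcal B(H),\qquad(*)$$ where the double sum is the limit, in the weak operator topology, of the sums over $i,j\in F$ along the finite sets $F$ of indices directed by inclusion. For every positive trace class operator $\rho$ on $H_n$ the sums in $(*)$ converge and define a bounded operator $\mathcal L$ on $\mathcal B(H)$. (2) If $\mathcal L$ and a positive trace class operator $\rho$ are related by $(*)$, then $\|\mathcal L\|=\mathrm{Tr}\,\rho=\sum_{i=1}^n\rho(i,i)$, and $\mathcal L$ is non-degenerate (in the sense of each of the three conditions above) if and only if $\mathrm{Tr}\,\rho=1$. (3) A matrix $\{r(i,j)\}_{i,j=1}^n$ of complex numbers is the matrix of a positive trace class operator on $H_n$ if and only if $\sum_{i,j}r(i,j)z_i\overline{z_j}\ge0$ for all finitely supported families $(z_i)_{i=1}^n$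 in $\mathbb C$ and $\sum_{i=1}^nr(i,i)<\infty$. -/

import Mathlib

open Filter Topology
open scoped ComplexOrder ComplexConjugate

namespace TransferBH

/-- `L : A → A` is a transfer operator for the endomorphism `α` of the unital C⋆-algebra `A`:
a continuous positive linear map with `L (α(a) b) = a L(b)`. -/
structure IsTransferOperator {A : Type*} [CStarAlgebra A] [PartialOrder A] [StarOrderedRing A]
    (α : A →⋆ₙₐ[ℂ] A) (L : A →ₗ[ℂ] A) : Prop where
  continuous : Continuous L
  positive : ∀ a : A, 0 ≤ a → 0 ≤ L a
  transfer : ∀ a b : A, L (α a * b) = a * L b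

/-- A (positive) linear map is normal if it preserves the least upper bounds of bounded increasing
nets (equivalently: of nonempty upwards directed sets) of self-adjoint elements. -/
def IsNormalMap {A : Type*} [CStarAlgebra A] [PartialOrder A] [StarOrderedRing A]
    (T : A →ₗ[ℂ] A) : Prop :=
  ∀ (S : Set A) (s : A), S.Nonempty → DirectedOn (· ≤ ·) S → (∀ a ∈ S, IsSelfAdjoint a) →
    IsLUB S s → IsLUB (T '' S) (T s)

/-- `E` is a conditional expectation of the C⋆-algebra `A` onto its C⋆-subalgebra `B`:
a contractive positive linear projection onto `B` which is a `B`-bimodule map. -/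
structure IsConditionalExpectation {A : Type*} [CStarAlgebra A] [PartialOrder A] [StarOrderedRing A]
    (E : A →ₗ[ℂ] A) (B : NonUnitalStarSubalgebra ℂ A) : Prop where
  mem : ∀ a : A, E a ∈ B
  apply_of_mem : ∀ b ∈ B, E b = b
  norm_le : ∀ a : A, ‖E a‖ ≤ ‖a‖
  positive : ∀ a : A, 0 ≤ a → 0 ≤ E a
  map_mul_left : ∀ b ∈ B, ∀ a : A, E (b * a) = b * E a
  map_mul_right : ∀ b ∈ B, ∀ a : A, E (a * b) = E a * b

/-- A transfer operator `L` for `α` is non-degenerate if `α ∘ L` is a conditional expectation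
onto the range of `α`. -/
def IsNondegenerate {A : Type*} [CStarAlgebra A] [PartialOrder A] [StarOrderedRing A]
    (α : A →⋆ₙₐ[ℂ] A) (L : A →ₗ[ℂ] A) : Prop :=
  IsConditionalExpectation ((α : A →ₗ[ℂ] A) ∘ₗ L) (NonUnitalStarAlgHom.range α)

/-- The index set with `n` elements, `n ∈ {0, 1, 2, …, ∞}`. -/
abbrev Idx (n : ℕ∞) : Type := {i : ℕ // (i : ℕ∞) < n}

/-- The Hilbert space `H_n` of dimension `n` with its fixed orthonormal basis: `ℓ²` over the
`n`-element index set. -/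
abbrev Hn (n : ℕ∞) : Type := lp (fun _ : Idx n => ℂ) 2

/-- The vectors of the standard orthonormal basis of `H_n`. -/
noncomputable def stdVec {n : ℕ∞} (i : Idx n) : Hn n := lp.single 2 i (1 : ℂ)

/-- The matrix entries `ρ(i,j) = ⟨ρ e_j, e_i⟩` (the inner product of Mathlib is linear in its
second argument). -/
noncomputable def entry {n : ℕ∞} (ρ : Hn n →L[ℂ] Hn n) (i j : Idx n) : ℂ :=
  inner ℂ (stdVec i) (ρ (stdVec j))

/-- `ρ` is a positive trace class operator: `ρ ≥ 0` and `∑ ⟨ρ e_i, e_i⟩ < ∞`. -/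
def IsPositiveTraceClass {n : ℕ∞} (ρ : Hn n →L[ℂ] Hn n) : Prop :=
  ρ.IsPositive ∧ Summable fun i : Idx n => (entry ρ i i).re

/-- The trace `∑ ρ(i,i)` of a positive trace class operator. -/
noncomputable def trace {n : ℕ∞} (ρ : Hn n →L[ℂ] Hn n) : ℝ :=
  ∑' i : Idx n, (entry ρ i i).re

section Operators

variable {H : Type*} [NormedAddCommGroup H] [InnerProductSpace ℂ H] [CompleteSpace H]

/-- `f k → T` in the weak operator topology. -/
def WeakTendsto {κ : Type*} (f : κ → (H →L[ℂ] H)) (l : Filter κ) (T : H →L[ℂ] H) : Prop :=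
  Tendsto (fun k => (ContinuousLinearMapWOT.ofCLM (f k) : H →WOT[ℂ] H)) l
    (𝓝 (ContinuousLinearMapWOT.ofCLM T))

/-- `(U_i)` is a family of isometries with pairwise orthogonal ranges such that
`α(a) = ∑ U_i a U_i^*`, the sum being weakly convergent. -/
structure IsIsometryFamily (α : (H →L[ℂ] H) →⋆ₙₐ[ℂ] (H →L[ℂ] H)) {n : ℕ∞}
    (U : Idx n → (H →L[ℂ] H)) : Prop where
  isometry : ∀ i, Isometry (U i)
  orthogonal : ∀ i j, i ≠ j → ∀ x y : H, inner ℂ (U i x) (U j y) = 0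
  sum : ∀ a : H →L[ℂ] H,
    WeakTendsto (fun F : Finset (Idx n) => ∑ i ∈ F, U i * a * star (U i)) atTop (α a)

/-- `L(a) = ∑_{i,j} ρ(i,j) U_i^* a U_j` for all `a`, the sum being the weak limit of the
square partial sums `∑_{i,j ∈ F}` over the finite sets `F` of indices. (For infinite `n` the
double family is in general not weakly summable over arbitrary finite sets of pairs.) -/
def HasTransferForm {n : ℕ∞} (U : Idx n → (H →L[ℂ] H)) (ρ : Hn n →L[ℂ] Hn n)
    (L : (H →L[ℂ] H) →ₗ[ℂ] (H →L[ℂ] H)) : Prop :=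
  ∀ a : H →L[ℂ] H,
    WeakTendsto (fun F : Finset (Idx n) => ∑ i ∈ F, ∑ j ∈ F, entry ρ i j • (star (U i) * a * U j))
      atTop (L a)

end Operators

end TransferBH

/-!
Every non-zero `*`-endomorphism `α` of `B(H)`, for `H` separable, is a sum of conjugations by
isometries `U i` with orthogonal ranges, and the normal transfer operators of `α` correspond to the
positive trace class operators on the multiplicity space.

*Existence of the isometries.* For a unit vector `e` and an orthonormal basis `b i` of the range of
the projection `α (|e⟩⟨e|)`, put `U i x = α (|x⟩⟨e|) (b i)`. Then `α a * U i = U i * a`, and a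
vector orthogonal to all the ranges is killed by `α` of every finite rank operator. By
`map_apply_eq_zero_of_rankOne` it is killed by `α` of every operator: there are uncountably many
isometries `V t` of `H` for which `star (V s) * V t` has finite rank when `s ≠ t`, and a vector
that survives would be mapped by the `α (V t)` to an uncountable orthogonal family of vectors of
equal norm.

*From trace class operators to transfer operators.* A positive trace class `ρ` is a Gram matrix,
`ρ(i,j) = ∑ₖ conj c(k,i) * c(k,j)` with `c` Hilbert–Schmidt. The operators `W k = ∑ⱼ c(k,j) • U j`
converge in norm, `star (W k) * W k = ‖W k‖ ^ 2 • 1`, and `∑ₖ ‖W k‖ ^ 2` is the trace of `ρ`. The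
square partial sums of the transfer form then converge in norm to `∑ₖ star (W k) * a * W k`
(`exists_isKrausFamily`). The transfer identity, the value at `1` and the norm can be read off from
this expression. Normality follows by dominated convergence, because a bounded increasing net of
operators converges strongly to its supremum (`tendsto_apply_of_isLUB`).

*From transfer operators to trace class operators.* A transfer operator `L` maps `U i * star (U j)`
into the centre of `B(H)`, hence to a scalar `r(i,j)`. The matrix `r` is positive, its diagonal is
summable because `L 1` is bounded, and such a matrix is that of a positive trace class operator
(`exists_isPositiveTraceClass`). On the corner of a finite set of indices `L` is given by the finite
transfer form; if `L` is normal, the complements of the corners become negligible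
(`exists_of_isNormalMap`).
-/

namespace TransferBH

/-! ### The weak operator topology and the Loewner order -/

section

variable {H : Type*} [NormedAddCommGroup H] [InnerProductSpace ℂ H]

theorem nonneg_iff_inner {T : H →L[ℂ] H} : 0 ≤ T ↔ ∀ x, 0 ≤ inner ℂ x (T x) := by
  rw [ContinuousLinearMap.nonneg_iff_isPositive]
  refine ⟨fun h x => h.inner_nonneg_right x, fun h => ?_⟩
  rw [ContinuousLinearMap.isPositive_iff_complex]
  intro x
  have h1 : 0 ≤ inner ℂ (T x) x := by
    rw [← inner_conj_symm]
    simpa using star_nonneg_iff.2 (h x)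
  rw [Complex.le_def] at h1
  refine ⟨?_, by simpa using h1.1⟩
  apply Complex.ext <;> simp
  simpa using h1.2

/-- The centre of `B(H)` consists of scalars: commuting with the rank one operators `|x⟩⟨e|` is
enough. -/
theorem eq_smul_one_of_forall_commute {T : H →L[ℂ] H} (hT : ∀ a : H →L[ℂ] H, a * T = T * a) {e : H}
    (he : ‖e‖ = 1) : T = (inner ℂ e (T e)) • (1 : H →L[ℂ] H) := by
  ext x
  have h := congrArg (fun S : H →L[ℂ] H => S e) (hT (InnerProductSpace.rankOne ℂ x e))
  simpa [inner_self_eq_norm_sq_to_K, he] using h.symm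

variable [CompleteSpace H]

theorem le_iff_inner {S T : H →L[ℂ] H} :
    S ≤ T ↔ ∀ x, inner ℂ x (S x) ≤ inner ℂ x (T x) := by
  rw [← sub_nonneg, nonneg_iff_inner]
  simp

theorem re_inner_le_of_le {S T : H →L[ℂ] H} (h : S ≤ T) (x : H) :
    (inner ℂ x (S x)).re ≤ (inner ℂ x (T x)).re :=
  (Complex.le_def.1 (le_iff_inner.1 h x)).1

/-- An operator is determined by its diagonal matrix coefficients. -/
theorem eq_of_inner_self_eq {S T : H →L[ℂ] H} (h : ∀ x, inner ℂ x (S x) = inner ℂ x (T x)) :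
    S = T :=
  le_antisymm (le_iff_inner.2 fun x => (h x).le) (le_iff_inner.2 fun x => (h x).ge)

theorem weakTendsto_iff {κ : Type*} {f : κ → (H →L[ℂ] H)} {l : Filter κ} {T : H →L[ℂ] H} :
    WeakTendsto f l T ↔
      ∀ x y : H, Tendsto (fun k => inner ℂ y (f k x)) l (𝓝 (inner ℂ y (T x))) :=
  ContinuousLinearMapWOT.tendsto_iff_forall_inner_apply_tendsto

theorem WeakTendsto.unique {κ : Type*} {f : κ → (H →L[ℂ] H)} {l : Filter κ} [l.NeBot]
    {T T' : H →L[ℂ] H} (h : WeakTendsto f l T) (h' : WeakTendsto f l T') : T = T' := by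
  rw [weakTendsto_iff] at h h'
  ext x
  exact ext_inner_left ℂ fun y => tendsto_nhds_unique (h x y) (h' x y)

theorem weakTendsto_of_tendsto_apply {κ : Type*} {f : κ → (H →L[ℂ] H)} {l : Filter κ}
    {T : H →L[ℂ] H} (h : ∀ x, Tendsto (fun k => f k x) l (𝓝 (T x))) : WeakTendsto f l T :=
  weakTendsto_iff.2 fun x _ => tendsto_const_nhds.inner (h x)

theorem weakTendsto_of_tendsto {κ : Type*} {f : κ → (H →L[ℂ] H)} {l : Filter κ}
    {T : H →L[ℂ] H} (h : Tendsto f l (𝓝 T)) : WeakTendsto f l T :=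
  weakTendsto_of_tendsto_apply fun x =>
    ((ContinuousLinearMap.apply ℂ H x).continuous.tendsto T).comp h

theorem WeakTendsto.mul_right {κ : Type*} {f : κ → (H →L[ℂ] H)} {l : Filter κ}
    {T : H →L[ℂ] H} (h : WeakTendsto f l T) (S : H →L[ℂ] H) :
    WeakTendsto (fun k => f k * S) l (T * S) := by
  rw [weakTendsto_iff] at h ⊢
  exact fun x y => h (S x) y

theorem exists_isSelfAdjoint_mul_self {T : H →L[ℂ] H} (hT : 0 ≤ T) :
    ∃ R : H →L[ℂ] H, star R = R ∧ R * R = T :=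
  ⟨CFC.sqrt T, (CFC.sqrt_nonneg T).isSelfAdjoint, CFC.sqrt_mul_sqrt_self T hT⟩

/-- The Cauchy–Schwarz inequality for the form of a positive operator, in the shape in which it
turns weak into strong convergence. -/
theorem norm_apply_sq_le_of_nonneg {T : H →L[ℂ] H} (hT : 0 ≤ T) (x : H) :
    ‖T x‖ ^ 2 ≤ ‖T‖ * (inner ℂ x (T x)).re := by
  obtain ⟨R, hRs, hRR⟩ := exists_isSelfAdjoint_mul_self hT
  have h1 : ‖T‖ = ‖R‖ * ‖R‖ := by
    rw [← CStarRing.norm_star_mul_self, hRs, hRR]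
  have h2 : (inner ℂ x (T x)).re = ‖R x‖ ^ 2 := by
    have : inner ℂ x (T x) = inner ℂ (R x) (R x) := by
      rw [← hRR, mul_apply_eq_comp, ← ContinuousLinearMap.adjoint_inner_left,
        ← ContinuousLinearMap.star_eq_adjoint, hRs]
    rw [this, inner_self_eq_norm_sq_to_K]
    norm_cast
  have h3 : ‖T x‖ ≤ ‖R‖ * ‖R x‖ := by
    rw [← hRR]; exact R.le_opNorm _
  rw [h1, h2]
  calc ‖T x‖ ^ 2 ≤ (‖R‖ * ‖R x‖) ^ 2 := by gcongr
    _ = _ := by ring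

/-- **Vigier's theorem**: an upwards directed set of operators converges strongly to its least
upper bound. -/
theorem tendsto_apply_of_isLUB {S : Set (H →L[ℂ] H)} {s : H →L[ℂ] H} (hne : S.Nonempty)
    (hdir : DirectedOn (· ≤ ·) S) (hs : IsLUB S s) (x : H) :
    Tendsto (fun a : S => (a : H →L[ℂ] H) x) atTop (𝓝 (s x)) := by
  obtain ⟨a₀, ha₀⟩ := hne
  have : Nonempty S := ⟨⟨a₀, ha₀⟩⟩
  have : IsDirectedOrder S := ⟨fun a b => by
    obtain ⟨c, hc, h1, h2⟩ := hdir a a.2 b b.2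
    exact ⟨⟨c, hc⟩, h1, h2⟩⟩
  set C := ‖s - a₀‖ with hC
  have key : ∀ a b : S, a₀ ≤ a → a ≤ b → ∀ x, ‖(b : H →L[ℂ] H) x - (a : H →L[ℂ] H) x‖ ^ 2 ≤
      C * ((inner ℂ x ((b : H →L[ℂ] H) x)).re - (inner ℂ x ((a : H →L[ℂ] H) x)).re) := by
    intro a b h0 hab x
    have hab' : (a : H →L[ℂ] H) ≤ b := hab
    have h1 : 0 ≤ (b : H →L[ℂ] H) - a := sub_nonneg.2 hab'
    have h2 : ‖(b : H →L[ℂ] H) - a‖ ≤ C :=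
      CStarAlgebra.norm_le_norm_of_nonneg_of_le h1 (sub_le_sub (hs.1 b.2) h0)
    have h3 := norm_apply_sq_le_of_nonneg h1 x
    simp only [sub_apply, inner_sub_right, Complex.sub_re] at h3
    refine h3.trans (mul_le_mul_of_nonneg_right h2 ?_)
    exact sub_nonneg.2 (re_inner_le_of_le hab' x)
  have hcauchy : ∀ x, ∃ y, Tendsto (fun a : S => (a : H →L[ℂ] H) x) atTop (𝓝 y) := by
    intro x
    have hmono : Monotone fun a : S => (inner ℂ x ((a : H →L[ℂ] H) x)).re :=
      fun a b hab => re_inner_le_of_le hab x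
    have hbdd : BddAbove (Set.range fun a : S => (inner ℂ x ((a : H →L[ℂ] H) x)).re) :=
      ⟨(inner ℂ x (s x)).re, by rintro _ ⟨a, rfl⟩; exact re_inner_le_of_le (hs.1 a.2) x⟩
    have hlim := tendsto_atTop_ciSup hmono hbdd
    set m := ⨆ a : S, (inner ℂ x ((a : H →L[ℂ] H) x)).re
    refine cauchy_map_iff_exists_tendsto.1 (Metric.cauchy_iff.2 ⟨inferInstance, fun ε hε => ?_⟩)
    obtain ⟨a, ha0, ha⟩ : ∃ a : S, ⟨a₀, ha₀⟩ ≤ a ∧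
        C * (m - (inner ℂ x ((a : H →L[ℂ] H) x)).re) < (ε / 2) ^ 2 := by
      have h1 : Tendsto (fun a : S => C * (m - (inner ℂ x ((a : H →L[ℂ] H) x)).re)) atTop
          (𝓝 (C * (m - m))) := (tendsto_const_nhds.sub hlim).const_mul C
      rw [sub_self, mul_zero] at h1
      exact ((eventually_ge_atTop _).and
        (h1.eventually (gt_mem_nhds (by positivity : 0 < (ε / 2) ^ 2)))).exists
    have hclose : ∀ b : S, a ≤ b → dist ((b : H →L[ℂ] H) x) ((a : H →L[ℂ] H) x) < ε / 2 := by
      intro b hab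
      rw [dist_eq_norm]
      refine lt_of_pow_lt_pow_left₀ 2 (by positivity) ((key a b ha0 hab x).trans_lt ?_)
      refine lt_of_le_of_lt (mul_le_mul_of_nonneg_left ?_ (norm_nonneg _)) ha
      exact sub_le_sub_right (le_ciSup hbdd b) _
    refine ⟨_, image_mem_map (Ici_mem_atTop a), ?_⟩
    rintro _ ⟨b, hb, rfl⟩ _ ⟨c, hc, rfl⟩
    exact (dist_triangle_right _ _ _).trans_lt
      (by linarith [hclose b hb, hclose c hc])
  choose t ht using hcauchy
  -- the pointwise limit is a bounded operator, and it is an upper bound below `s`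
  let T₀ : H →ₗ[ℂ] H := linearMapOfTendsto (l := (atTop : Filter S)) t
    (fun a => ((a : H →L[ℂ] H) : H →ₗ[ℂ] H)) (tendsto_pi_nhds.2 ht)
  let T : H →L[ℂ] H := T₀.mkContinuous (C + ‖a₀‖) (by
    intro x
    refine le_of_tendsto (ht x).norm ?_
    filter_upwards [eventually_ge_atTop ⟨a₀, ha₀⟩] with a ha
    have ha' : a₀ ≤ (a : H →L[ℂ] H) := ha
    refine (ContinuousLinearMap.le_opNorm _ _).trans
      (mul_le_mul_of_nonneg_right ?_ (norm_nonneg _))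
    have h2 : ‖(a : H →L[ℂ] H) - a₀‖ ≤ C :=
      CStarAlgebra.norm_le_norm_of_nonneg_of_le (sub_nonneg.2 ha') (sub_le_sub_right (hs.1 a.2) _)
    calc ‖(a : H →L[ℂ] H)‖ = ‖((a : H →L[ℂ] H) - a₀) + a₀‖ := by rw [sub_add_cancel]
      _ ≤ _ := (norm_add_le _ _).trans (by gcongr))
  have hT : ∀ x, Tendsto (fun a : S => inner ℂ x ((a : H →L[ℂ] H) x)) atTop
      (𝓝 (inner ℂ x (T x))) := fun x => tendsto_const_nhds.inner (ht x)
  have hle : T ≤ s := le_iff_inner.2 fun x =>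
    le_of_tendsto' (hT x) fun a => le_iff_inner.1 (hs.1 a.2) x
  have hge : s ≤ T := hs.2 fun b hb => le_iff_inner.2 fun x => by
    refine ge_of_tendsto (hT x) ?_
    filter_upwards [eventually_ge_atTop ⟨b, hb⟩] with a ha
    exact le_iff_inner.1 (show b ≤ (a : H →L[ℂ] H) from ha) x
  rw [← le_antisymm hle hge]
  exact ht x

/-- A weakly convergent increasing family of operators has its limit as least upper bound. -/
theorem isLUB_of_weakTendsto {κ : Type*} [Preorder κ] [IsDirectedOrder κ] [Nonempty κ]
    {f : κ → (H →L[ℂ] H)} {T : H →L[ℂ] H} (hf : Monotone f) (h : WeakTendsto f atTop T) :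
    IsLUB (Set.range f) T := by
  rw [weakTendsto_iff] at h
  constructor
  · rintro _ ⟨k, rfl⟩
    refine le_iff_inner.2 fun x => ge_of_tendsto (h x x) ?_
    filter_upwards [eventually_ge_atTop k] with l hl
    exact le_iff_inner.1 (hf hl) x
  · intro c hc
    exact le_iff_inner.2 fun x => le_of_tendsto' (h x x) fun k => le_iff_inner.1 (hc ⟨k, rfl⟩) x

end

/-! ### Families of isometries with orthogonal ranges -/

section

variable {H : Type*} [NormedAddCommGroup H] [InnerProductSpace ℂ H] [CompleteSpace H]

namespace IsIsometryFamily

variable {α : (H →L[ℂ] H) →⋆ₙₐ[ℂ] (H →L[ℂ] H)} {n : ℕ∞} {U : Idx n → (H →L[ℂ] H)}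

theorem star_mul_self (hU : IsIsometryFamily α U) (i : Idx n) : star (U i) * U i = 1 := by
  have h := (U i).norm_map_iff_adjoint_comp_self.1
    ((AddMonoidHomClass.isometry_iff_norm (U i)).1 (hU.isometry i))
  exact h

theorem star_mul_of_ne (hU : IsIsometryFamily α U) {i j : Idx n} (hij : i ≠ j) :
    star (U i) * U j = 0 := by
  ext x
  refine ext_inner_left ℂ fun y => ?_
  rw [mul_apply_eq_comp, ContinuousLinearMap.star_eq_adjoint,
    ContinuousLinearMap.adjoint_inner_right, hU.orthogonal i j hij]
  simp

theorem map_mul (hU : IsIsometryFamily α U) (a : H →L[ℂ] H) (i : Idx n) :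
    α a * U i = U i * a := by
  refine ((hU.sum a).mul_right (U i)).unique (weakTendsto_of_tendsto ?_)
  refine tendsto_const_nhds.congr' ?_
  filter_upwards [eventually_ge_atTop {i}] with F hF
  have hi : i ∈ F := by simpa using hF
  rw [Finset.sum_mul, Finset.sum_eq_single_of_mem i hi]
  · rw [mul_assoc, hU.star_mul_self, mul_one]
  · intro j _ hj
    rw [mul_assoc, hU.star_mul_of_ne hj, mul_zero]

theorem star_mul_map (hU : IsIsometryFamily α U) (a : H →L[ℂ] H) (i : Idx n) :
    star (U i) * α a = a * star (U i) := by
  have h := congrArg star (hU.map_mul (star a) i)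
  simpa [map_star] using h

theorem star_sum_mul_sum (hU : IsIsometryFamily α U) (F : Finset (Idx n)) (c d : Idx n → ℂ) :
    star (∑ i ∈ F, c i • U i) * ∑ j ∈ F, d j • U j =
      (∑ i ∈ F, conj (c i) * d i) • (1 : H →L[ℂ] H) := by
  rw [star_sum, Finset.sum_mul, Finset.sum_smul]
  refine Finset.sum_congr rfl fun i hi => ?_
  rw [Finset.mul_sum, Finset.sum_eq_single_of_mem i hi]
  · rw [star_smul, smul_mul_smul_comm, hU.star_mul_self]; rfl
  · intro j _ hj
    rw [star_smul, smul_mul_smul_comm, hU.star_mul_of_ne hj.symm, smul_zero]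

theorem norm_sum_sq [Nontrivial H] (hU : IsIsometryFamily α U) (F : Finset (Idx n))
    (c : Idx n → ℂ) : ‖∑ i ∈ F, c i • U i‖ ^ 2 = ∑ i ∈ F, ‖c i‖ ^ 2 := by
  rw [pow_two, ← CStarRing.norm_star_mul_self, hU.star_sum_mul_sum, norm_smul, norm_one, mul_one]
  have : (∑ i ∈ F, conj (c i) * c i) = ((∑ i ∈ F, ‖c i‖ ^ 2 : ℝ) : ℂ) := by
    push_cast
    exact Finset.sum_congr rfl fun i _ => Complex.conj_mul' _
  rw [this, Complex.norm_of_nonneg (Finset.sum_nonneg fun i _ => by positivity)]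

/-- Square summable combinations of the isometries converge in norm: the closed span of the `U i`
is a Hilbert space whose inner product is `star T * S`. -/
theorem summable_smul [Nontrivial H] (hU : IsIsometryFamily α U) {c : Idx n → ℂ}
    (hc : Summable fun i => ‖c i‖ ^ 2) : Summable fun i => c i • U i := by
  rw [summable_iff_vanishing_norm] at hc ⊢
  intro ε hε
  obtain ⟨s, hs⟩ := hc (ε ^ 2) (by positivity)
  refine ⟨s, fun t ht => lt_of_pow_lt_pow_left₀ 2 hε.le ?_⟩
  rw [hU.norm_sum_sq]
  exact (le_abs_self _).trans_lt (hs t ht)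

theorem norm_tsum_sq [Nontrivial H] (hU : IsIsometryFamily α U) {c : Idx n → ℂ}
    (hc : Summable fun i => ‖c i‖ ^ 2) : ‖∑' i, c i • U i‖ ^ 2 = ∑' i, ‖c i‖ ^ 2 := by
  refine tendsto_nhds_unique (((hU.summable_smul hc).hasSum.norm).pow 2) ?_
  simp_rw [hU.norm_sum_sq]
  exact hc.hasSum

theorem star_tsum_mul_tsum [Nontrivial H] (hU : IsIsometryFamily α U) {c : Idx n → ℂ}
    (hc : Summable fun i => ‖c i‖ ^ 2) :
    star (∑' i, c i • U i) * ∑' i, c i • U i =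
      ((‖∑' i, c i • U i‖ ^ 2 : ℝ) : ℂ) • (1 : H →L[ℂ] H) := by
  have h := (hU.summable_smul hc).hasSum
  refine tendsto_nhds_unique (Tendsto.mul h.star h) ?_
  have h2 : Tendsto (fun F : Finset (Idx n) =>
      ((‖∑ i ∈ F, c i • U i‖ ^ 2 : ℝ) : ℂ) • (1 : H →L[ℂ] H)) atTop
      (𝓝 (((‖∑' i, c i • U i‖ ^ 2 : ℝ) : ℂ) • (1 : H →L[ℂ] H))) :=
    (((Complex.continuous_ofReal.tendsto _).comp (h.norm.pow 2))).smul_const _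
  refine h2.congr fun F => ?_
  rw [hU.norm_sum_sq, ← star_sum, hU.star_sum_mul_sum]
  congr 1
  push_cast
  exact Finset.sum_congr rfl fun i _ => (Complex.conj_mul' _).symm

theorem map_mul_tsum [Nontrivial H] (hU : IsIsometryFamily α U) {c : Idx n → ℂ}
    (hc : Summable fun i => ‖c i‖ ^ 2) (a : H →L[ℂ] H) :
    α a * ∑' i, c i • U i = (∑' i, c i • U i) * a := by
  have h := hU.summable_smul hc
  rw [← h.tsum_mul_left, ← h.tsum_mul_right]
  simp [hU.map_mul]

end IsIsometryFamily

/-! ### Kraus families of positive trace class operators -/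

/-- A Kraus family for the endomorphism `α`, of total weight `t`: operators `W k` that intertwine
`α` with the identity, each a multiple of an isometry, with `∑ ‖W k‖ ^ 2 = t`. -/
structure IsKrausFamily (α : (H →L[ℂ] H) →⋆ₙₐ[ℂ] (H →L[ℂ] H)) {κ : Type*}
    (W : κ → (H →L[ℂ] H)) (t : ℝ) : Prop where
  hasSum : HasSum (fun k => ‖W k‖ ^ 2) t
  star_mul_self : ∀ k, star (W k) * W k = ((‖W k‖ ^ 2 : ℝ) : ℂ) • (1 : H →L[ℂ] H)
  map_mul : ∀ k a, α a * W k = W k * a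

section

variable {n : ℕ∞}

theorem inner_stdVec (i : Idx n) (f : Hn n) : inner ℂ (stdVec i) f = f i := by
  simp [stdVec, lp.inner_single_left]

theorem hasSum_norm_sq (f : Hn n) : HasSum (fun k => ‖f k‖ ^ 2) (‖f‖ ^ 2) := by
  have h := lp.hasSum_norm (p := 2) (by norm_num) f
  simpa using h

/-- The matrix of a positive trace class operator is the Gram matrix `∑ₖ conj c(k,i) * c(k,j)` of a
Hilbert–Schmidt matrix `c`, that of the square root of the operator. -/
theorem exists_gram {ρ : Hn n →L[ℂ] Hn n} (hρ : IsPositiveTraceClass ρ) :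
    ∃ c : Idx n → Idx n → ℂ, (∀ i j, HasSum (fun k => conj (c k i) * c k j) (entry ρ i j)) ∧
      (∀ k, Summable fun j => ‖c k j‖ ^ 2) ∧
      HasSum (fun k => ∑' j, ‖c k j‖ ^ 2) (trace ρ) := by
  have hρ0 : 0 ≤ ρ := (ContinuousLinearMap.nonneg_iff_isPositive ρ).2 hρ.1
  obtain ⟨S, hSs, hSS⟩ := exists_isSelfAdjoint_mul_self hρ0
  have hentry : ∀ i j, entry ρ i j = inner ℂ (S (stdVec i)) (S (stdVec j)) := by
    intro i j
    rw [entry, ← hSS, mul_apply_eq_comp, ← ContinuousLinearMap.adjoint_inner_left,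
      ← ContinuousLinearMap.star_eq_adjoint, hSs]
  have hcol : ∀ j, HasSum (fun k => ‖S (stdVec j) k‖ ^ 2) (entry ρ j j).re := by
    intro j
    rw [hentry, inner_self_eq_norm_sq_to_K]
    have := hasSum_norm_sq (S (stdVec j))
    norm_cast
  have hsum : Summable fun p : Idx n × Idx n => ‖S (stdVec p.1) p.2‖ ^ 2 := by
    refine (summable_prod_of_nonneg fun p => by positivity).2 ⟨fun j => (hcol j).summable, ?_⟩
    exact hρ.2.congr fun j => ((hcol j).tsum_eq).symm
  have hswap : Summable fun p : Idx n × Idx n => ‖S (stdVec p.2) p.1‖ ^ 2 := hsum.prod_symm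
  refine ⟨fun k j => S (stdVec j) k, fun i j => ?_, fun k => hswap.prod_factor k, ?_⟩
  · rw [hentry]
    have h := lp.hasSum_inner (𝕜 := ℂ) (S (stdVec i)) (S (stdVec j))
    simpa [mul_comm] using h
  · have h1 := hswap.prod.hasSum
    have h2 : ∑' k, ∑' j, ‖S (stdVec j) k‖ ^ 2 = trace ρ := by
      rw [Summable.tsum_comm (f := fun j k => ‖S (stdVec j) k‖ ^ 2) hsum, trace]
      exact tsum_congr fun j => (hcol j).tsum_eq
    rwa [h2] at h1

variable {α : (H →L[ℂ] H) →⋆ₙₐ[ℂ] (H →L[ℂ] H)} {U : Idx n → (H →L[ℂ] H)}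

theorem norm_conj_le (W a : H →L[ℂ] H) : ‖star W * a * W‖ ≤ ‖W‖ ^ 2 * ‖a‖ :=
  calc ‖star W * a * W‖ ≤ ‖W‖ * ‖a‖ * ‖W‖ := by
        refine (norm_mul_le _ _).trans ?_
        gcongr
        exact (norm_mul_le _ _).trans_eq (by rw [norm_star])
    _ = _ := by ring

/-- With the Gram matrix `c` of `exists_gram`, the operators `W k = ∑ⱼ c(k,j) U j` turn the double
sum of the transfer form into the single sum `∑ₖ star (W k) * a * W k`, which converges in norm. -/
theorem exists_isKrausFamily [Nontrivial H] (hU : IsIsometryFamily α U) {ρ : Hn n →L[ℂ] Hn n}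
    (hρ : IsPositiveTraceClass ρ) :
    ∃ W : Idx n → (H →L[ℂ] H), IsKrausFamily α W (trace ρ) ∧ ∀ a : H →L[ℂ] H,
      Tendsto (fun F : Finset (Idx n) => ∑ i ∈ F, ∑ j ∈ F, entry ρ i j • (star (U i) * a * U j))
        atTop (𝓝 (∑' k, star (W k) * a * W k)) := by
  obtain ⟨c, hgram, hrow, htr⟩ := exists_gram hρ
  refine ⟨fun k => ∑' j, c k j • U j, ⟨?_, fun k => hU.star_tsum_mul_tsum (hrow k),
    fun k a => hU.map_mul_tsum (hrow k) a⟩, fun a => ?_⟩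
  · simpa only [hU.norm_tsum_sq (hrow _)] using htr
  have hpart : ∀ F : Finset (Idx n),
      ∑ i ∈ F, ∑ j ∈ F, entry ρ i j • (star (U i) * a * U j) =
        ∑' k, star (∑ i ∈ F, c k i • U i) * a * ∑ j ∈ F, c k j • U j := by
    intro F
    have h1 : HasSum (fun k => ∑ i ∈ F, ∑ j ∈ F, (conj (c k i) * c k j) • (star (U i) * a * U j))
        (∑ i ∈ F, ∑ j ∈ F, entry ρ i j • (star (U i) * a * U j)) :=
      hasSum_sum fun i _ => hasSum_sum fun j _ => (hgram i j).smul_const _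
    rw [← h1.tsum_eq]
    refine tsum_congr fun k => ?_
    rw [star_sum, Finset.sum_mul, Finset.sum_mul]
    refine Finset.sum_congr rfl fun i _ => ?_
    rw [Finset.mul_sum]
    refine Finset.sum_congr rfl fun j _ => ?_
    rw [star_smul, smul_mul_assoc, smul_mul_smul_comm]
    rfl
  simp_rw [hpart]
  refine tendsto_tsum_of_dominated_convergence (htr.summable.mul_right ‖a‖) (fun k => ?_)
    (Eventually.of_forall fun F k => ?_)
  · have h := (hU.summable_smul (hrow k)).hasSum
    have h' := Tendsto.mul (Tendsto.mul h.star (tendsto_const_nhds (x := a))) h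
    simpa only [← star_sum, SummationFilter.unconditional_filter] using h'
  · have hn : ‖∑ j ∈ F, c k j • U j‖ ^ 2 ≤ ∑' j, ‖c k j‖ ^ 2 := by
      rw [hU.norm_sum_sq]
      exact (hrow k).sum_le_tsum F fun j _ => by positivity
    exact (norm_conj_le _ a).trans (mul_le_mul_of_nonneg_right hn (norm_nonneg a))

end

namespace IsKrausFamily

variable {α : (H →L[ℂ] H) →⋆ₙₐ[ℂ] (H →L[ℂ] H)} {κ : Type*} {W : κ → (H →L[ℂ] H)} {t : ℝ}

theorem summable (hW : IsKrausFamily α W t) (a : H →L[ℂ] H) :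
    Summable fun k => star (W k) * a * W k :=
  Summable.of_norm_bounded (hW.hasSum.summable.mul_right ‖a‖) fun _ => norm_conj_le _ _

theorem weight_nonneg (hW : IsKrausFamily α W t) : 0 ≤ t :=
  hW.hasSum.nonneg fun k => by positivity

theorem norm_tsum_le (hW : IsKrausFamily α W t) (a : H →L[ℂ] H) :
    ‖∑' k, star (W k) * a * W k‖ ≤ t * ‖a‖ :=
  tsum_of_norm_bounded (hW.hasSum.mul_right ‖a‖) fun _ => norm_conj_le _ _

theorem tsum_one (hW : IsKrausFamily α W t) :
    ∑' k, star (W k) * 1 * W k = (t : ℂ) • (1 : H →L[ℂ] H) := by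
  simp_rw [mul_one, hW.star_mul_self]
  exact ((Complex.hasSum_ofReal.2 hW.hasSum).smul_const _).tsum_eq

/-- The completely positive map `a ↦ ∑ₖ star (W k) * a * W k` of a Kraus family. -/
noncomputable def map (hW : IsKrausFamily α W t) : (H →L[ℂ] H) →L[ℂ] (H →L[ℂ] H) :=
  LinearMap.mkContinuous
    { toFun := fun a => ∑' k, star (W k) * a * W k
      map_add' := fun a b => by
        rw [← (hW.summable a).tsum_add (hW.summable b)]
        simp_rw [mul_add, add_mul]
      map_smul' := fun z a => by
        rw [RingHom.id_apply, ← (hW.summable a).tsum_const_smul]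
        simp_rw [mul_smul_comm, smul_mul_assoc] } t hW.norm_tsum_le

theorem map_apply (hW : IsKrausFamily α W t) (a : H →L[ℂ] H) :
    hW.map a = ∑' k, star (W k) * a * W k := rfl

theorem norm_map [Nontrivial H] (hW : IsKrausFamily α W t) : ‖hW.map‖ = t := by
  refine le_antisymm (LinearMap.mkContinuous_norm_le _ hW.weight_nonneg _) ?_
  have h := hW.map.le_opNorm 1
  rwa [map_apply, hW.tsum_one, norm_smul, norm_one, mul_one, mul_one,
    Complex.norm_of_nonneg hW.weight_nonneg] at h

theorem hasSum_inner (hW : IsKrausFamily α W t) (a : H →L[ℂ] H) (x : H) :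
    HasSum (fun k => inner ℂ (W k x) (a (W k x))) (inner ℂ x (hW.map a x)) := by
  have h : HasSum (fun k => star (W k) * a * W k) (hW.map a) := (hW.summable a).hasSum
  have h2 := (h.mapL (ContinuousLinearMap.apply ℂ H x)).mapL (innerSL ℂ x)
  simpa [ContinuousLinearMap.star_eq_adjoint, ContinuousLinearMap.adjoint_inner_right] using h2

theorem isTransferOperator (hW : IsKrausFamily α W t) :
    IsTransferOperator α (hW.map : (H →L[ℂ] H) →ₗ[ℂ] (H →L[ℂ] H)) where
  continuous := hW.map.continuous
  positive a ha := tsum_nonneg fun k => star_left_conjugate_nonneg ha (W k)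
  transfer a b := by
    have hs : ∀ k, star (W k) * α a = a * star (W k) := fun k => by
      simpa [map_star] using congrArg star (hW.map_mul k (star a))
    change ∑' k, star (W k) * (α a * b) * W k = a * ∑' k, star (W k) * b * W k
    rw [← (hW.summable b).tsum_mul_left]
    refine tsum_congr fun k => ?_
    rw [← mul_assoc, hs, mul_assoc, mul_assoc, mul_assoc]

theorem isNormalMap (hW : IsKrausFamily α W t) :
    IsNormalMap (hW.map : (H →L[ℂ] H) →ₗ[ℂ] (H →L[ℂ] H)) := by
  intro S s hne hdir _ hs
  have hmono : ∀ a b : H →L[ℂ] H, a ≤ b → hW.map a ≤ hW.map b := fun a b hab => by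
    rw [← sub_nonneg, ← map_sub]
    exact hW.isTransferOperator.positive _ (sub_nonneg.2 hab)
  refine ⟨by rintro _ ⟨a, ha, rfl⟩; exact hmono _ _ (hs.1 ha), fun c hc => ?_⟩
  have hconv := tendsto_apply_of_isLUB hne hdir hs
  obtain ⟨a₀, ha₀⟩ := hne
  have : Nonempty S := ⟨⟨a₀, ha₀⟩⟩
  have : IsDirectedOrder S := ⟨fun a b => by
    obtain ⟨c, hc, h1, h2⟩ := hdir a a.2 b b.2
    exact ⟨⟨c, hc⟩, h1, h2⟩⟩
  refine le_iff_inner.2 fun x => ?_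
  have hlim : Tendsto (fun a : S => inner ℂ x (hW.map a x)) atTop
      (𝓝 (inner ℂ x (hW.map s x))) := by
    simp_rw [← fun a => (hW.hasSum_inner a x).tsum_eq]
    refine tendsto_tsum_of_dominated_convergence
      (hW.hasSum.summable.mul_right ((‖s - a₀‖ + ‖s‖) * ‖x‖ ^ 2))
      (fun k => tendsto_const_nhds.inner (hconv (W k x))) ?_
    filter_upwards [eventually_ge_atTop ⟨a₀, ha₀⟩] with a ha k
    have ha' : a₀ ≤ (a : H →L[ℂ] H) := ha
    have h1 : ‖s - (a : H →L[ℂ] H)‖ ≤ ‖s - a₀‖ :=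
      CStarAlgebra.norm_le_norm_of_nonneg_of_le (sub_nonneg.2 (hs.1 a.2)) (sub_le_sub_left ha' s)
    have h2 : ‖(a : H →L[ℂ] H)‖ ≤ ‖s - a₀‖ + ‖s‖ := by
      calc ‖(a : H →L[ℂ] H)‖ = ‖s - (s - a)‖ := by rw [sub_sub_cancel]
        _ ≤ ‖s‖ + ‖s - a‖ := norm_sub_le _ _
        _ ≤ _ := by linarith
    calc ‖inner ℂ (W k x) ((a : H →L[ℂ] H) (W k x))‖
        ≤ ‖W k x‖ * ‖(a : H →L[ℂ] H) (W k x)‖ := norm_inner_le_norm _ _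
      _ ≤ (‖W k‖ * ‖x‖) * ((‖s - a₀‖ + ‖s‖) * (‖W k‖ * ‖x‖)) := by
          have h3 := (W k).le_opNorm x
          have h4 : ‖(a : H →L[ℂ] H) (W k x)‖ ≤ (‖s - a₀‖ + ‖s‖) * (‖W k‖ * ‖x‖) :=
            ((a : H →L[ℂ] H).le_opNorm _).trans (by gcongr)
          gcongr
      _ = _ := by ring
  exact le_of_tendsto' hlim fun a => le_iff_inner.1 (hc ⟨a, a.2, rfl⟩) x

end IsKrausFamily

end

/-! ### Matrices of positive trace class operators -/

section Matrices

variable {n : ℕ∞}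

theorem inner_sum_stdVec (ρ : Hn n →L[ℂ] Hn n) (F : Finset (Idx n)) (c : Idx n → ℂ) :
    inner ℂ (∑ i ∈ F, c i • stdVec i) (ρ (∑ j ∈ F, c j • stdVec j)) =
      ∑ i ∈ F, ∑ j ∈ F, entry ρ i j * conj (c i) * c j := by
  simp only [map_sum, map_smul, sum_inner, inner_sum, inner_smul_left, inner_smul_right, entry,
    Finset.mul_sum]
  rw [Finset.sum_comm]
  exact Finset.sum_congr rfl fun i _ => Finset.sum_congr rfl fun j _ => by ring

theorem sum_entry_nonneg {ρ : Hn n →L[ℂ] Hn n} (hρ : ρ.IsPositive) (F : Finset (Idx n))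
    (c : Idx n → ℂ) : 0 ≤ ∑ i ∈ F, ∑ j ∈ F, entry ρ i j * c i * conj (c j) := by
  have h := hρ.inner_nonneg_right (∑ i ∈ F, conj (c i) • stdVec i)
  rw [inner_sum_stdVec ρ F fun i => conj (c i)] at h
  simpa using h

section Pos

variable {ι : Type*} {r : ι → ι → ℂ}

theorem sum_nonneg_of_forall_finsupp
    (hr : ∀ z : ι →₀ ℂ, 0 ≤ ∑ i ∈ z.support, ∑ j ∈ z.support, r i j * z i * conj (z j))
    (F : Finset ι) (c : ι → ℂ) : 0 ≤ ∑ i ∈ F, ∑ j ∈ F, r i j * c i * conj (c j) := by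
  classical
  let z : ι →₀ ℂ := Finsupp.indicator F fun i _ => c i
  have hz : ∀ i ∈ F, z i = c i := fun i hi => Finsupp.indicator_of_mem hi _
  have hs : z.support ⊆ F := Finsupp.support_indicator_subset _ _
  have h := hr z
  rw [Finset.sum_subset hs fun i _ hi => by simp [Finsupp.notMem_support_iff.1 hi]] at h
  refine h.trans_eq (Finset.sum_congr rfl fun i hi => ?_)
  rw [Finset.sum_subset hs fun j _ hj => by simp [Finsupp.notMem_support_iff.1 hj]]
  exact Finset.sum_congr rfl fun j hj => by rw [hz i hi, hz j hj]

variable (hr : ∀ (F : Finset ι) (c : ι → ℂ), 0 ≤ ∑ i ∈ F, ∑ j ∈ F, r i j * c i * conj (c j))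
include hr

theorem diag_nonneg_of_pos (i : ι) : 0 ≤ r i i := by
  simpa using hr {i} fun _ => 1

/-- The `2 × 2` minors of a positive matrix are nonnegative. -/
theorem norm_sq_le_of_pos (i j : ι) : ‖r i j‖ ^ 2 ≤ (r i i).re * (r j j).re := by
  classical
  have hi := Complex.le_def.1 (diag_nonneg_of_pos hr i)
  have hj := Complex.le_def.1 (diag_nonneg_of_pos hr j)
  simp only [Complex.zero_re, Complex.zero_im] at hi hj
  rcases eq_or_ne i j with rfl | hij
  · rw [← Complex.normSq_eq_norm_sq, Complex.normSq_apply, ← hi.2]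
    simp
  have h2 : ∀ a b : ℂ, 0 ≤ r i i * a * conj a + r i j * a * conj b +
      (r j i * b * conj a + r j j * b * conj b) := by
    intro a b
    have := hr {i, j} fun k => if k = i then a else b
    simpa [Finset.sum_pair hij, hij.symm] using this
  -- real values at `(1, 1)` and `(1, I)` force `r j i = conj (r i j)`
  have e1 := (Complex.le_def.1 (h2 1 1)).2
  have e2 := (Complex.le_def.1 (h2 1 Complex.I)).2
  simp [← hi.2, ← hj.2] at e1 e2
  -- the form at `(t * conj (r i j), 1)` is a nonnegative quadratic polynomial in `t`
  have hq : ∀ t : ℝ, 0 ≤ (‖r i j‖ ^ 2 * (r i i).re) * (t * t) + (2 * ‖r i j‖ ^ 2) * t +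
      (r j j).re := by
    intro t
    have h3 := (Complex.le_def.1 (h2 (t * conj (r i j)) 1)).1
    simp [← hi.2] at h3
    rw [← Complex.normSq_eq_norm_sq, Complex.normSq_apply]
    have e3 : (r j i).re = (r i j).re := by linarith
    have e4 : (r j i).im = -(r i j).im := by linarith
    rw [e3, e4] at h3
    nlinarith [h3]
  have hd := discrim_le_zero hq
  rw [discrim] at hd
  rcases (sq_nonneg ‖r i j‖).eq_or_lt with h0 | h0
  · rw [← h0]; exact mul_nonneg hi.1 hj.1
  · refine le_of_mul_le_mul_left ?_ h0
    nlinarith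

end Pos

/-- A positive matrix with summable diagonal is Hilbert–Schmidt, and so defines a bounded operator
on `ℓ²`. -/
theorem exists_isPositiveTraceClass {r : Idx n → Idx n → ℂ}
    (hr : ∀ (F : Finset (Idx n)) (c : Idx n → ℂ), 0 ≤ ∑ i ∈ F, ∑ j ∈ F, r i j * c i * conj (c j))
    (hs : Summable fun i => (r i i).re) :
    ∃ ρ : Hn n →L[ℂ] Hn n, IsPositiveTraceClass ρ ∧ ∀ i j, entry ρ i j = r i j := by
  have hrow : ∀ i, Summable fun j => ‖r i j‖ ^ 2 := fun i =>
    Summable.of_nonneg_of_le (fun j => by positivity) (norm_sq_le_of_pos hr i)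
      (hs.mul_left (r i i).re)
  -- the rows of the matrix, conjugated, so that the operator acts by inner products with them
  let v : Idx n → Hn n := fun i => ⟨fun j => conj (r i j),
    (memℓp_gen_iff (by norm_num)).2 (by simpa using hrow i)⟩
  have hv : ∀ i, ‖v i‖ ^ 2 ≤ (r i i).re * ∑' j, (r j j).re := by
    intro i
    rw [← (hasSum_norm_sq (v i)).tsum_eq, ← tsum_mul_left]
    refine Summable.tsum_le_tsum (fun j => ?_) (hasSum_norm_sq (v i)).summable (hs.mul_left _)
    simpa [v] using norm_sq_le_of_pos hr i j
  set T := ∑' j, (r j j).re with hT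
  have hT0 : 0 ≤ T := tsum_nonneg fun j => (Complex.le_def.1 (diag_nonneg_of_pos hr j)).1
  have hb : ∀ (y : Hn n) i, ‖inner ℂ (v i) y‖ ^ 2 ≤ (r i i).re * (T * ‖y‖ ^ 2) := fun y i => by
    calc ‖inner ℂ (v i) y‖ ^ 2 ≤ (‖v i‖ * ‖y‖) ^ 2 := by gcongr; exact norm_inner_le_norm _ _
      _ = ‖v i‖ ^ 2 * ‖y‖ ^ 2 := by ring
      _ ≤ ((r i i).re * T) * ‖y‖ ^ 2 := by gcongr; exact hv i
      _ = _ := by ring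
  have hmem : ∀ y : Hn n, Memℓp (fun i => (inner ℂ (v i) y : ℂ)) 2 := fun y =>
    (memℓp_gen_iff (by norm_num)).2 (by
      simpa using Summable.of_nonneg_of_le (fun i => by positivity) (hb y) (hs.mul_right _))
  let ρ₀ : Hn n →ₗ[ℂ] Hn n :=
    { toFun := fun y => ⟨fun i => inner ℂ (v i) y, hmem y⟩
      map_add' := fun y z => by ext i; exact inner_add_right (v i) y z
      map_smul' := fun c y => by ext i; exact inner_smul_right (v i) y c }
  let ρ : Hn n →L[ℂ] Hn n := ρ₀.mkContinuous T (by
    intro y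
    refine le_of_sq_le_sq ?_ (by positivity)
    rw [← (hasSum_norm_sq (ρ₀ y)).tsum_eq]
    calc ∑' i, ‖ρ₀ y i‖ ^ 2 ≤ ∑' i, (r i i).re * (T * ‖y‖ ^ 2) :=
          Summable.tsum_le_tsum (hb y) (hasSum_norm_sq (ρ₀ y)).summable (hs.mul_right _)
      _ = (T * ‖y‖) ^ 2 := by rw [tsum_mul_right, ← hT]; ring)
  have hentry : ∀ i j, entry ρ i j = r i j := by
    intro i j
    rw [entry, inner_stdVec]
    change inner ℂ (v i) (stdVec j) = _
    rw [← inner_conj_symm, inner_stdVec]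
    simp [v]
  refine ⟨ρ, ⟨?_, by simpa only [hentry] using hs⟩, hentry⟩
  rw [← ContinuousLinearMap.nonneg_iff_isPositive, nonneg_iff_inner]
  intro y
  have hy : Tendsto (fun F : Finset (Idx n) => ∑ i ∈ F, y i • stdVec i) atTop (𝓝 y) := by
    have h := lp.hasSum_single (p := 2) (by norm_num) y
    refine Tendsto.congr (fun F => ?_) h
    refine Finset.sum_congr rfl fun i _ => ?_
    rw [stdVec, ← lp.single_smul]; simp
  -- positivity passes from the finitely supported vectors to the limit
  have hlim := hy.inner (𝕜 := ℂ) ((ρ.continuous.tendsto y).comp hy)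
  refine ge_of_tendsto' hlim fun F => ?_
  have h := hr F fun i => conj (y i)
  rw [Function.comp_apply, inner_sum_stdVec ρ F fun i => y i]
  simpa [hentry] using h

end Matrices

/-! ### Normal transfer operators -/

section

variable {H : Type*} [NormedAddCommGroup H] [InnerProductSpace ℂ H] [CompleteSpace H]

section Positive

variable {L : (H →L[ℂ] H) →ₗ[ℂ] (H →L[ℂ] H)} (hL : ∀ a, 0 ≤ a → 0 ≤ L a)
include hL

theorem map_star_of_positive (a : H →L[ℂ] H) : L (star a) = star (L a) :=
  map_star (PositiveLinearMap.mk₀ L hL) a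

/-- The Cauchy–Schwarz inequality for the positive functional `a ↦ ⟪x, L a x⟫`. -/
theorem norm_inner_map_star_mul_sq_le (a b : H →L[ℂ] H) (x : H) :
    ‖inner ℂ x (L (star a * b) x)‖ ^ 2 ≤
      (inner ℂ x (L (star a * a) x)).re * (inner ℂ x (L (star b * b) x)).re := by
  let φ₀ : (H →L[ℂ] H) →ₗ[ℂ] ℂ :=
    { toFun := fun a => inner ℂ x (L a x)
      map_add' := fun a b => by simp
      map_smul' := fun c a => by simp }
  let φ : (H →L[ℂ] H) →ₚ[ℂ] ℂ :=
    PositiveLinearMap.mk₀ φ₀ fun a ha => nonneg_iff_inner.1 (hL a ha) x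
  have h := norm_inner_le_norm (𝕜 := ℂ) (φ.toPreGNS a) (φ.toPreGNS b)
  have hn : ∀ c : H →L[ℂ] H, ‖φ.toPreGNS c‖ ^ 2 = (inner ℂ x (L (star c * c) x)).re := fun c => by
    have := congrArg Complex.re (φ.preGNS_norm_sq (φ.toPreGNS c))
    rw [← Complex.ofReal_pow, Complex.ofReal_re] at this
    exact this
  rw [← hn, ← hn, ← mul_pow]
  exact pow_le_pow_left₀ (norm_nonneg _) h 2

end Positive

section Necessity

variable {α : (H →L[ℂ] H) →⋆ₙₐ[ℂ] (H →L[ℂ] H)} {n : ℕ∞} {U : Idx n → (H →L[ℂ] H)}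
  {L : (H →L[ℂ] H) →ₗ[ℂ] (H →L[ℂ] H)}

theorem IsTransferOperator.map_mul_right (hL : IsTransferOperator α L) (a b : H →L[ℂ] H) :
    L (b * α a) = L b * a := by
  have h := congrArg star (hL.transfer (star a) (star b))
  rw [← map_star_of_positive hL.positive, star_mul, star_mul,
    ← map_star_of_positive hL.positive] at h
  simpa [map_star] using h

theorem IsTransferOperator.map_one_eq (hL : IsTransferOperator α L) : L (α 1) = L 1 := by
  simpa using hL.transfer 1 1

/-- A transfer operator is determined up to scalars on the corners `U i * B(H) * star (U j)`,
because it maps the matrix unit `U i * star (U j)` into the centre of `B(H)`. -/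
theorem IsTransferOperator.exists_matrix [Nontrivial H] (hL : IsTransferOperator α L)
    (hU : IsIsometryFamily α U) :
    ∃ r : Idx n → Idx n → ℂ, ∀ i j a, L (U i * a * star (U j)) = r i j • a := by
  obtain ⟨e, he⟩ := exists_norm_eq H zero_le_one
  refine ⟨fun i j => inner ℂ e (L (U i * star (U j)) e), fun i j a => ?_⟩
  have h1 : ∀ a, L (U i * a * star (U j)) = a * L (U i * star (U j)) := fun a => by
    rw [← hU.map_mul, mul_assoc, hL.transfer]
  have h2 : ∀ a, L (U i * a * star (U j)) = L (U i * star (U j)) * a := fun a => by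
    rw [mul_assoc, ← hU.star_mul_map, ← mul_assoc, hL.map_mul_right]
  rw [h1, eq_smul_one_of_forall_commute (fun a => (h1 a).symm.trans (h2 a)) he]
  simp

theorem IsIsometryFamily.star_sum_self (F : Finset (Idx n)) :
    star (∑ i ∈ F, U i * star (U i)) = ∑ i ∈ F, U i * star (U i) := by
  simp

theorem IsIsometryFamily.sum_mul_sum (hU : IsIsometryFamily α U) (F : Finset (Idx n)) :
    (∑ i ∈ F, U i * star (U i)) * ∑ i ∈ F, U i * star (U i) = ∑ i ∈ F, U i * star (U i) := by
  rw [Finset.sum_mul]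
  refine Finset.sum_congr rfl fun i hi => ?_
  rw [Finset.mul_sum, Finset.sum_eq_single_of_mem i hi]
  · rw [mul_assoc, ← mul_assoc (star _), hU.star_mul_self, one_mul]
  · intro j _ hj
    rw [mul_assoc, ← mul_assoc (star _), hU.star_mul_of_ne hj.symm, zero_mul, mul_zero]

theorem IsIsometryFamily.norm_sum_le_one (hU : IsIsometryFamily α U) (F : Finset (Idx n)) :
    ‖∑ i ∈ F, U i * star (U i)‖ ≤ 1 :=
  IsStarProjection.norm_le _ ⟨hU.sum_mul_sum F, star_sum_self F⟩

theorem IsIsometryFamily.isLUB_sum (hU : IsIsometryFamily α U) :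
    IsLUB (Set.range fun F : Finset (Idx n) => ∑ i ∈ F, U i * star (U i)) (α 1) := by
  refine isLUB_of_weakTendsto (fun F G hFG => ?_) (by simpa using hU.sum 1)
  exact Finset.sum_le_sum_of_subset_of_nonneg hFG fun i _ _ => mul_star_self_nonneg _

/-- The normal transfer operators have the transfer form. With `P F = ∑ i ∈ F, U i * star (U i)`,
normality and the fact that the `L (P F)` are scalars give `L (1 - P F) → 0` in norm, and then the
Cauchy–Schwarz inequality gives `L (P F * a * P F) → L a` weakly. -/
theorem exists_of_isNormalMap [Nontrivial H] (hU : IsIsometryFamily α U)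
    (hL : IsTransferOperator α L) (hN : IsNormalMap L) :
    ∃ ρ : Hn n →L[ℂ] Hn n, IsPositiveTraceClass ρ ∧ HasTransferForm U ρ L := by
  obtain ⟨r, hr⟩ := hL.exists_matrix hU
  obtain ⟨e, he⟩ := exists_norm_eq H zero_le_one
  have hr1 : ∀ i j, L (U i * star (U j)) = r i j • 1 := fun i j => by simpa using hr i j 1
  set P : Finset (Idx n) → (H →L[ℂ] H) := fun F => ∑ i ∈ F, U i * star (U i) with hP
  have hmono : ∀ a b : H →L[ℂ] H, a ≤ b → L a ≤ L b := fun a b hab => by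
    rw [← sub_nonneg, ← map_sub]
    exact hL.positive _ (sub_nonneg.2 hab)
  have hpos : ∀ (F : Finset (Idx n)) (c : Idx n → ℂ),
      0 ≤ ∑ i ∈ F, ∑ j ∈ F, r i j * c i * conj (c j) := by
    intro F c
    have h := nonneg_iff_inner.1 (hL.positive _ (mul_star_self_nonneg (∑ i ∈ F, c i • U i))) e
    have h2 : L ((∑ i ∈ F, c i • U i) * star (∑ i ∈ F, c i • U i)) =
        (∑ i ∈ F, ∑ j ∈ F, r i j * c i * conj (c j)) • 1 := by
      simp only [star_sum, Finset.sum_mul, Finset.mul_sum, map_sum, Finset.sum_smul, star_smul,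
        smul_mul_smul_comm, map_smul, hr1, smul_smul]
      rw [Finset.sum_comm]
      refine Finset.sum_congr rfl fun i _ => Finset.sum_congr rfl fun j _ => ?_
      congr 1
      rw [Complex.star_def]
      ring
    rw [h2] at h
    simpa [he] using h
  have hdiag : ∀ i, r i i = ((r i i).re : ℂ) := fun i =>
    (Complex.ext rfl (Complex.le_def.1 (diag_nonneg_of_pos hpos i)).2.symm)
  have hLP : ∀ F, L (P F) = ((∑ i ∈ F, (r i i).re : ℝ) : ℂ) • (1 : H →L[ℂ] H) := fun F => by
    rw [hP, map_sum, Complex.ofReal_sum, Finset.sum_smul]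
    exact Finset.sum_congr rfl fun i _ => by rw [hr1, ← hdiag]
  have hlub : IsLUB (Set.range P) (α 1) := hU.isLUB_sum
  have hs : Summable fun i => (r i i).re := by
    refine summable_of_sum_le (c := (inner ℂ e (L (α 1) e)).re)
      (fun i => (Complex.le_def.1 (diag_nonneg_of_pos hpos i)).1) fun F => ?_
    have h := re_inner_le_of_le (hmono _ _ (hlub.1 ⟨F, rfl⟩)) e
    rw [hLP] at h
    simpa [he] using h
  obtain ⟨ρ, hρ, hentry⟩ := exists_isPositiveTraceClass hpos hs
  set t := ∑' i, (r i i).re with ht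
  -- normality at the increasing net `P F` with supremum `α 1`
  have hL1 : L 1 = (t : ℂ) • (1 : H →L[ℂ] H) := by
    have h1 : IsLUB (L '' Set.range P) (L (α 1)) := by
      refine hN _ _ ⟨P ∅, ∅, rfl⟩ ?_ ?_ hlub
      · rintro _ ⟨F, rfl⟩ _ ⟨G, rfl⟩
        have hle : Monotone P := fun F G hFG =>
          Finset.sum_le_sum_of_subset_of_nonneg hFG fun i _ _ => mul_star_self_nonneg _
        exact ⟨P (F ∪ G), ⟨_, rfl⟩, hle Finset.subset_union_left, hle Finset.subset_union_right⟩
      · rintro _ ⟨F, rfl⟩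
        exact IsIsometryFamily.star_sum_self F
    have h2 : IsLUB (Set.range fun F => L (P F)) ((t : ℂ) • (1 : H →L[ℂ] H)) := by
      refine isLUB_of_weakTendsto (fun F G hFG => hmono _ _ ?_) (weakTendsto_of_tendsto ?_)
      · exact Finset.sum_le_sum_of_subset_of_nonneg hFG fun i _ _ => mul_star_self_nonneg _
      · simp_rw [hLP]
        exact ((Complex.continuous_ofReal.tendsto _).comp hs.hasSum).smul_const _
    rw [← hL.map_one_eq]
    rw [← Set.range_comp] at h1
    exact h1.unique h2
  refine ⟨ρ, hρ, ?_⟩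
  obtain ⟨W, hW, hlim⟩ := exists_isKrausFamily hU hρ
  obtain ⟨C, hC⟩ := (PositiveLinearMap.mk₀ L hL.positive).exists_norm_apply_le
  have hC' : ∀ a, ‖L a‖ ≤ C * ‖a‖ := hC
  have hcut : ∀ F a, L (P F * a * P F) =
      ∑ i ∈ F, ∑ j ∈ F, entry ρ i j • (star (U i) * a * U j) := by
    intro F a
    simp only [hP, Finset.sum_mul, Finset.mul_sum, map_sum]
    rw [Finset.sum_comm]
    refine Finset.sum_congr rfl fun i _ => Finset.sum_congr rfl fun j _ => ?_
    rw [hentry, ← hr]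
    simp only [mul_assoc]
  -- Cauchy–Schwarz against the complement of `P F`, where `L (1 - P F)` is a small scalar
  have hQ : ∀ x F (y : H →L[ℂ] H), ‖inner ℂ x (L (star y * (1 - P F)) x)‖ ^ 2 ≤
      (C * ‖y‖ ^ 2 * ‖x‖ ^ 2) * ((t - ∑ i ∈ F, (r i i).re) * ‖x‖ ^ 2) := by
    intro x F y
    refine (norm_inner_map_star_mul_sq_le hL.positive y (1 - P F) x).trans ?_
    have hQQ : star (1 - P F) * (1 - P F) = 1 - P F := by
      rw [star_sub, star_one, IsIsometryFamily.star_sum_self, sub_mul, one_mul, mul_sub,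
        mul_one, hU.sum_mul_sum F, sub_self, sub_zero]
    have hLQ : (inner ℂ x (L (1 - P F) x)).re = (t - ∑ i ∈ F, (r i i).re) * ‖x‖ ^ 2 := by
      rw [map_sub, hL1, hLP, ← sub_smul, ← Complex.ofReal_sub]
      simp [inner_self_eq_norm_sq_to_K, ← Complex.ofReal_pow]
    rw [hQQ, hLQ]
    refine mul_le_mul_of_nonneg_right ?_ ?_
    · refine (Complex.re_le_norm _).trans ((norm_inner_le_norm _ _).trans ?_)
      have h1 : ‖L (star y * y) x‖ ≤ (C * ‖y‖ ^ 2) * ‖x‖ := by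
        refine (ContinuousLinearMap.le_opNorm _ _).trans ?_
        gcongr
        refine (hC' _).trans_eq ?_
        rw [CStarRing.norm_star_mul_self, pow_two]
      calc ‖x‖ * ‖L (star y * y) x‖ ≤ ‖x‖ * ((C * ‖y‖ ^ 2) * ‖x‖) := by gcongr
        _ = _ := by ring
    · refine mul_nonneg (sub_nonneg.2 (hs.sum_le_tsum F fun i _ => ?_)) (by positivity)
      exact (Complex.le_def.1 (diag_nonneg_of_pos hpos i)).1
  have hLW : ∀ a, L a = hW.map a := by
    intro a
    refine eq_of_inner_self_eq fun x => ?_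
    have h1 : Tendsto (fun F => inner ℂ x (L (P F * a * P F) x)) atTop
        (𝓝 (inner ℂ x (hW.map a x))) := by
      simp_rw [hcut]
      exact weakTendsto_iff.1 (weakTendsto_of_tendsto (hlim a)) x x
    refine tendsto_nhds_unique ?_ h1
    have h0 : Tendsto (fun F : Finset (Idx n) =>
        √((C * ‖a‖ ^ 2 * ‖x‖ ^ 2) * ((t - ∑ i ∈ F, (r i i).re) * ‖x‖ ^ 2))) atTop (𝓝 0) := by
      have h := (((tendsto_const_nhds (x := t)).sub hs.hasSum).mul_const (‖x‖ ^ 2)).const_mul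
        (C * ‖a‖ ^ 2 * ‖x‖ ^ 2)
      rw [ht, sub_self, zero_mul, mul_zero] at h
      simpa using h.sqrt
    refine tendsto_iff_norm_sub_tendsto_zero.2 ?_
    refine squeeze_zero (fun _ => norm_nonneg _) (fun F => ?_) (by simpa using h0.add h0)
    have hsplit : P F * a * P F - a =
        -star (star a * (1 - P F)) - star (star a * P F) * (1 - P F) := by
      have hPs : star (P F) = P F := IsIsometryFamily.star_sum_self F
      simp only [star_mul, star_sub, star_one, star_star, hPs]
      noncomm_ring
    rw [← inner_sub_right, ← sub_apply, ← map_sub, hsplit, map_sub, map_neg, sub_apply, neg_apply,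
      inner_sub_right, inner_neg_right]
    refine (norm_sub_le _ _).trans (add_le_add ?_ ?_)
    · rw [norm_neg, map_star_of_positive hL.positive, ContinuousLinearMap.star_eq_adjoint,
        ContinuousLinearMap.adjoint_inner_right, ← inner_conj_symm, RCLike.norm_conj]
      exact Real.le_sqrt_of_sq_le (hQ x F a)
    · refine Real.le_sqrt_of_sq_le ((hQ x F _).trans ?_)
      have h1 : ‖star a * P F‖ ≤ ‖a‖ :=
        (norm_mul_le _ _).trans ((mul_le_mul_of_nonneg_left (hU.norm_sum_le_one F)
          (norm_nonneg _)).trans_eq (by rw [norm_star, mul_one]))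
      have h2 : 0 ≤ t - ∑ i ∈ F, (r i i).re := sub_nonneg.2 (hs.sum_le_tsum F fun i _ =>
        (Complex.le_def.1 (diag_nonneg_of_pos hpos i)).1)
      gcongr
  intro a
  rw [hLW]
  exact weakTendsto_of_tendsto (hlim a)

end Necessity

end

/-! ### Endomorphisms of `B(H)` are implemented by isometries -/

section

variable {H : Type*} [NormedAddCommGroup H] [InnerProductSpace ℂ H]

theorem countable_of_pairwise_orthogonal [TopologicalSpace.SeparableSpace H] {ι : Type*}
    (f : ι → H) {c : ℝ} (hc : 0 < c) (hn : ∀ i, ‖f i‖ = c)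
    (ho : ∀ i j, i ≠ j → inner ℂ (f i) (f j) = 0) : Countable ι := by
  have hd : ∀ i j, i ≠ j → c ≤ dist (f i) (f j) := by
    intro i j hij
    rw [dist_eq_norm]
    refine le_of_sq_le_sq ?_ (norm_nonneg _)
    rw [@norm_sub_sq ℂ, ho i j hij, hn, hn]
    simp only [map_zero, mul_zero, sub_zero]
    nlinarith
  rw [← Set.countable_univ_iff]
  refine Set.PairwiseDisjoint.countable_of_isOpen (s := fun i => Metric.ball (f i) (c / 2))
    ?_ (fun i _ => Metric.isOpen_ball) fun i _ => ⟨f i, Metric.mem_ball_self (by positivity)⟩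
  intro i _ j _ hij
  exact Metric.ball_disjoint_ball (by linarith [hd i j hij])

/-- The index sets `Idx n` exhaust the countable cardinalities. -/
theorem exists_equiv_idx (ι : Type*) [Countable ι] : ∃ n : ℕ∞, Nonempty (Idx n ≃ ι) := by
  cases finite_or_infinite ι
  · refine ⟨(Nat.card ι : ℕ∞), ⟨?_⟩⟩
    refine (Equiv.subtypeEquivRight fun i => ?_).trans
      (Fin.equivSubtype.symm.trans (Finite.equivFin ι).symm)
    exact Nat.cast_lt
  · obtain ⟨_⟩ := nonempty_denumerable ι
    exact ⟨⊤, ⟨(Equiv.subtypeUnivEquiv fun i => ENat.natCast_lt_top i).trans (Denumerable.eqv ι).symm⟩⟩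

theorem eq_sum_rankOne_of_apply_eq_zero (b : HilbertBasis ℕ ℂ H) (A : H →L[ℂ] H) (m : ℕ)
    (hA : ∀ k, m ≤ k → A (b k) = 0) :
    A = ∑ k ∈ Finset.range m, InnerProductSpace.rankOne ℂ (A (b k)) (b k) := by
  ext x
  have h1 : HasSum (fun k => b.repr x k • A (b k)) (A x) := by
    simpa using (b.hasSum_repr x).mapL A
  refine h1.unique ?_
  rw [sum_apply]
  simp only [InnerProductSpace.rankOne_apply, ← b.repr_apply_apply]
  exact hasSum_sum_of_ne_finset_zero fun k hk => by
    rw [hA k (by simpa using hk), smul_zero]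

variable [CompleteSpace H]

/-- For a Hilbert basis indexed by `ℕ` and a sequence `t` of bits, the isometry that maps the
`k`-th basis vector to the one numbered by the first `k` bits of `t`. Two of these isometries have
almost orthogonal ranges. -/
theorem exists_almost_orthogonal_isometries (b : HilbertBasis ℕ ℂ H) :
    ∃ V : (ℕ → Bool) → (H →L[ℂ] H), (∀ t, star (V t) * V t = 1) ∧
      ∀ s t, s ≠ t → ∃ m, ∀ k, m ≤ k → (star (V s) * V t) (b k) = 0 := by
  let f : (ℕ → Bool) → ℕ → ℕ := fun t k => Encodable.encode ((List.range k).map t)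
  have hf : ∀ s t j k, f s j = f t k → j = k ∧ ∀ i < k, s i = t i := by
    intro s t j k h
    have h' := Encodable.encode_injective h
    have hjk : j = k := by simpa using congrArg List.length h'
    subst hjk
    exact ⟨rfl, fun i hi => List.map_inj_left.1 h' i (List.mem_range.2 hi)⟩
  have ho : ∀ t, Orthonormal ℂ fun k => b (f t k) := fun t =>
    b.orthonormal.comp (f t) fun j k h => (hf t t j k h).1
  let V : (ℕ → Bool) → (H →ₗᵢ[ℂ] H) := fun t =>
    (ho t).orthogonalFamily.linearIsometry.comp b.repr.toLinearIsometry
  have hV : ∀ t k, V t (b k) = b (f t k) := by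
    intro t k
    change (ho t).orthogonalFamily.linearIsometry (b.repr (b k)) = _
    rw [b.repr_self, OrthogonalFamily.linearIsometry_apply_single]
    simp
  refine ⟨fun t => (V t).toContinuousLinearMap, fun t => ?_, fun s t hst => ?_⟩
  · exact (ContinuousLinearMap.norm_map_iff_adjoint_comp_self _).1 (V t).norm_map
  · -- prefixes long enough to see a place where `s` and `t` differ are distinct
    obtain ⟨m, hm⟩ := Function.ne_iff.1 hst
    refine ⟨m + 1, fun k hk => ?_⟩
    have hzero : ∀ j, inner ℂ (b j) ((star (V s).toContinuousLinearMap *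
        (V t).toContinuousLinearMap) (b k)) = 0 := by
      intro j
      rw [mul_apply_eq_comp, ContinuousLinearMap.star_eq_adjoint,
        ContinuousLinearMap.adjoint_inner_right]
      change inner ℂ (V s (b j)) (V t (b k)) = 0
      rw [hV, hV]
      exact b.orthonormal.inner_eq_zero fun h => hm ((hf s t j k h).2 m (by omega))
    apply b.repr.injective
    ext j
    rw [b.repr_apply_apply, hzero]
    simp

variable (α : (H →L[ℂ] H) →⋆ₙₐ[ℂ] (H →L[ℂ] H))

theorem inner_map_apply_map_apply (a b : H →L[ℂ] H) (x y : H) :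
    inner ℂ (α a x) (α b y) = inner ℂ x (α (star a * b) y) := by
  rw [map_mul, map_star, mul_apply_eq_comp, ContinuousLinearMap.star_eq_adjoint,
    ContinuousLinearMap.adjoint_inner_right]

open InnerProductSpace in
/-- On a separable Hilbert space there is no singular part: a vector killed by the image of the
finite rank operators is killed by the image of all operators. Otherwise the images of this vector
under the almost orthogonal isometries would form an uncountable orthogonal family. -/
theorem map_apply_eq_zero_of_rankOne [TopologicalSpace.SeparableSpace H] {ξ : H}
    (hξ : ∀ x y, α (rankOne ℂ x y) ξ = 0) (a : H →L[ℂ] H) : α a ξ = 0 := by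
  suffices h1 : α 1 ξ = 0 by
    rw [← mul_one a, map_mul, mul_apply_eq_comp, h1, map_zero]
  obtain ⟨w, b, -⟩ := exists_hilbertBasis ℂ H
  have : Countable w := countable_of_pairwise_orthogonal b one_pos b.orthonormal.1
    fun i j hij => b.orthonormal.2 hij
  cases finite_or_infinite w
  · -- in finite dimension the identity itself is a sum of rank one operators
    have := Fintype.ofFinite w
    have h := b.toOrthonormalBasis.sum_rankOne_eq_id
    have h' : (1 : H →L[ℂ] H) = _ := h.symm
    rw [h', map_sum, sum_apply]
    exact Finset.sum_eq_zero fun i _ => hξ _ _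
  · obtain ⟨_⟩ := nonempty_denumerable w
    let g : ℕ ≃ w := (Denumerable.eqv w).symm
    have hsp : ⊤ ≤ (Submodule.span ℂ (Set.range (b ∘ g))).topologicalClosure := by
      rw [g.surjective.range_comp]
      exact b.dense_span.ge
    let b' : HilbertBasis ℕ ℂ H := HilbertBasis.mk (b.orthonormal.comp g g.injective) hsp
    obtain ⟨V, hV1, hV2⟩ := exists_almost_orthogonal_isometries b'
    by_contra hne
    have hcount : Countable (ℕ → Bool) := by
      refine countable_of_pairwise_orthogonal (fun t => α (V t) ξ) (norm_pos_iff.2 hne)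
        (fun t => ?_) fun s t hst => ?_
      · have h : inner ℂ (α (V t) ξ) (α (V t) ξ) = inner ℂ (α 1 ξ) (α 1 ξ) := by
          rw [inner_map_apply_map_apply, inner_map_apply_map_apply, hV1, star_one, one_mul]
        rw [@norm_eq_sqrt_re_inner ℂ, h, ← @norm_eq_sqrt_re_inner ℂ]
      · obtain ⟨m, hm⟩ := hV2 s t hst
        rw [inner_map_apply_map_apply, eq_sum_rankOne_of_apply_eq_zero b' _ m hm, map_sum,
          sum_apply, Finset.sum_eq_zero fun k _ => hξ _ _, inner_zero_right]
    classical
    obtain ⟨F, hF⟩ := exists_injective_nat (ℕ → Bool)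
    refine Function.cantor_injective (fun S : Set ℕ => F fun k => decide (k ∈ S)) fun S T hST => ?_
    ext k
    simpa using congrFun (hF hST) k

theorem nontrivial_of_ne_zero {α : (H →L[ℂ] H) →⋆ₙₐ[ℂ] (H →L[ℂ] H)} (hα : α ≠ 0) :
    Nontrivial H := by
  by_contra h
  rw [not_nontrivial_iff_subsingleton] at h
  exact hα (by ext a x; exact Subsingleton.elim _ _)

theorem map_one_ne_zero {α : (H →L[ℂ] H) →⋆ₙₐ[ℂ] (H →L[ℂ] H)} (hα : α ≠ 0) :
    α 1 ≠ 0 := by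
  intro h
  refine hα ?_
  ext a : 1
  have h1 : α a = α a * α 1 := by rw [← map_mul, mul_one]
  rw [h1, h, mul_zero]
  rfl

open InnerProductSpace in
/-- An orthonormal basis `(b i)` of the range of the projection `α (|e⟩⟨e|)` yields the isometries
`U i x = α (|x⟩⟨e|) (b i)`. -/
theorem exists_isIsometryFamily [TopologicalSpace.SeparableSpace H] (hα : α ≠ 0) :
    ∃ (n : ℕ∞) (U : Idx n → (H →L[ℂ] H)), 1 ≤ n ∧ IsIsometryFamily α U := by
  have := nontrivial_of_ne_zero hα
  obtain ⟨e, he⟩ := exists_norm_eq H zero_le_one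
  have hmul : ∀ x y z w : H, rankOne ℂ x y * rankOne ℂ z w = inner ℂ y z • rankOne ℂ x w :=
    fun x y z w => by ext v; simp [smul_smul, mul_comm]
  have hstar : ∀ x y : H, star (rankOne ℂ x y) = rankOne ℂ y x := fun x y => by
    rw [ContinuousLinearMap.star_eq_adjoint, adjoint_rankOne]
  have hee : inner ℂ e e = (1 : ℂ) := by simp [inner_self_eq_norm_sq_to_K, he]
  -- the range of the projection `α (rankOne ℂ e e)`, as its space of fixed vectors
  let M : Submodule ℂ H := LinearMap.ker ((1 - α (rankOne ℂ e e) : H →L[ℂ] H) : H →ₗ[ℂ] H)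
  have hM : ∀ v, v ∈ M ↔ α (rankOne ℂ e e) v = v := fun v => by
    rw [LinearMap.mem_ker, ContinuousLinearMap.coe_coe, sub_apply, sub_eq_zero, eq_comm]
    rfl
  have hMc : IsClosed (M : Set H) :=
    ContinuousLinearMap.isClosed_ker (1 - α (rankOne ℂ e e) : H →L[ℂ] H)
  have : CompleteSpace M := hMc.completeSpace_coe
  obtain ⟨w, b, -⟩ := exists_hilbertBasis ℂ M
  have hbo : Orthonormal ℂ fun i => (b i : H) := b.orthonormal.comp_linearIsometry M.subtypeₗᵢ
  have : Countable w := countable_of_pairwise_orthogonal (fun i => (b i : H)) one_pos hbo.1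
    fun i j hij => hbo.2 hij
  obtain ⟨n, ⟨g⟩⟩ := exists_equiv_idx w
  have hb : ∀ i, α (rankOne ℂ e e) (b i : H) = b i := fun i => (hM _).1 (b i).2
  have hinner : ∀ i j x y, inner ℂ (α (rankOne ℂ x e) (b i : H)) (α (rankOne ℂ y e) (b j : H)) =
      inner ℂ x y * inner ℂ (b i : H) (b j : H) := by
    intro i j x y
    rw [inner_map_apply_map_apply, hstar, hmul, map_smul, smul_apply, hb, inner_smul_right]
  let U : Idx n → (H →ₗᵢ[ℂ] H) := fun i =>
    { toFun := fun x => α (rankOne ℂ x e) (b (g i) : H)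
      map_add' := fun x y => by simp
      map_smul' := fun c x => by simp
      norm_map' := fun x => by
        change ‖α (rankOne ℂ x e) (b (g i) : H)‖ = ‖x‖
        rw [@norm_eq_sqrt_re_inner ℂ, hinner, @norm_eq_sqrt_re_inner ℂ _ _ _ _ x,
          inner_self_eq_norm_sq_to_K (b (g i) : H), hbo.1]
        simp }
  have hU : ∀ i x, U i x = α (rankOne ℂ x e) (b (g i) : H) := fun _ _ => rfl
  have hUo : ∀ i j, i ≠ j → ∀ x y, inner ℂ (U i x) (U j y) = 0 := by
    intro i j hij x y
    rw [hU, hU, hinner, hbo.2 (g.injective.ne hij), mul_zero]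
  have hfam : OrthogonalFamily ℂ (fun _ : Idx n => H) U := fun i j hij => hUo i j hij
  have hαU : ∀ a i x, α a (U i x) = U i (a x) := by
    intro a i x
    rw [hU, hU, ← mul_apply_eq_comp, ← map_mul]
    congr 2
    ext v
    simp
  -- no vector orthogonal to the ranges of the isometries is seen by `α`
  have hvanish : ∀ ξ : H, (∀ i x, inner ℂ (U i x) ξ = 0) → ∀ a, α a ξ = 0 := by
    intro ξ hξ
    refine map_apply_eq_zero_of_rankOne α fun x y => ?_
    have h1 : rankOne ℂ x y = rankOne ℂ x e * rankOne ℂ e y := by rw [hmul, hee, one_smul]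
    rw [h1, map_mul, mul_apply_eq_comp]
    have hη : α (rankOne ℂ e y) ξ ∈ M := by
      rw [hM, ← mul_apply_eq_comp, ← map_mul, hmul, hee, one_smul]
    have h0 : (⟨α (rankOne ℂ e y) ξ, hη⟩ : M) = 0 := by
      apply b.repr.injective
      ext j
      rw [b.repr_apply_apply, map_zero]
      change inner ℂ (b j : H) (α (rankOne ℂ e y) ξ) = 0
      have h2 := hξ (g.symm j) y
      rw [hU, g.apply_symm_apply] at h2
      rw [← h2, ← hstar y e, map_star, ContinuousLinearMap.star_eq_adjoint,
        ContinuousLinearMap.adjoint_inner_right]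
    have h3 : α (rankOne ℂ e y) ξ = 0 := congrArg Subtype.val h0
    rw [h3, map_zero]
  set V : Idx n → (H →L[ℂ] H) := fun i => (U i).toContinuousLinearMap with hV
  have hadj : ∀ i x y, inner ℂ (star (V i) x) y = inner ℂ x (U i y) := fun i x y => by
    rw [ContinuousLinearMap.star_eq_adjoint, ContinuousLinearMap.adjoint_inner_left]; rfl
  have hadj' : ∀ i x y, inner ℂ x (star (V i) y) = inner ℂ (U i x) y := fun i x y => by
    rw [ContinuousLinearMap.star_eq_adjoint, ContinuousLinearMap.adjoint_inner_right]; rfl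
  -- Bessel's inequality for the orthogonal ranges
  have hbessel : ∀ (ξ : H), Summable fun i => ‖star (V i) ξ‖ ^ 2 := by
    intro ξ
    refine summable_of_sum_le (c := ‖ξ‖ ^ 2) (fun i => by positivity) fun F => ?_
    have h1 : ‖∑ i ∈ F, U i (star (V i) ξ)‖ ^ 2 = ∑ i ∈ F, ‖star (V i) ξ‖ ^ 2 :=
      hfam.norm_sum (fun i => star (V i) ξ) F
    have h2 : inner ℂ ξ (∑ i ∈ F, U i (star (V i) ξ)) = ((∑ i ∈ F, ‖star (V i) ξ‖ ^ 2 : ℝ) : ℂ) := by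
      rw [inner_sum, Complex.ofReal_sum]
      refine Finset.sum_congr rfl fun i _ => ?_
      rw [← hadj, inner_self_eq_norm_sq_to_K]
      norm_cast
    have h3 := norm_inner_le_norm (𝕜 := ℂ) ξ (∑ i ∈ F, U i (star (V i) ξ))
    rw [h2, ← h1, Complex.norm_of_nonneg (by positivity)] at h3
    rw [← h1]
    nlinarith [norm_nonneg (∑ i ∈ F, U i (star (V i) ξ)), norm_nonneg ξ]
  have hsum : ∀ ξ, ∀ a, HasSum (fun i => U i (a (star (V i) ξ))) (α a ξ) := by
    intro ξ a
    have hs : Summable fun i => U i (star (V i) ξ) :=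
      (hfam.summable_iff_norm_sq_summable fun i => star (V i) ξ).2 (hbessel ξ)
    -- the sum of the `U i (star (V i) ξ)` is the projection of `ξ` to the span of the ranges
    have h1 : α a (ξ - ∑' i, U i (star (V i) ξ)) = 0 := by
      refine hvanish _ (fun j x => ?_) a
      have h2 : HasSum (fun i => inner ℂ (U j x) (U i (star (V i) ξ)))
          (inner ℂ (U j x) (∑' i, U i (star (V i) ξ))) := by
        simpa using hs.hasSum.mapL (innerSL ℂ (U j x))
      have h3 : HasSum (fun i => inner ℂ (U j x) (U i (star (V i) ξ)))
          (inner ℂ (U j x) (U j (star (V j) ξ))) :=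
        hasSum_single j fun i hi => hUo j i hi.symm _ _
      rw [inner_sub_right, h2.unique h3, (U j).inner_map_map, hadj', sub_self]
    rw [map_sub, sub_eq_zero] at h1
    rw [h1]
    simpa [hαU] using hs.hasSum.mapL (α a)
  have hfinal : IsIsometryFamily α V :=
    { isometry := fun i => (U i).isometry
      orthogonal := hUo
      sum := fun a => weakTendsto_of_tendsto_apply fun ξ => by
        have h : Tendsto (fun F : Finset (Idx n) => ∑ i ∈ F, U i (a (star (V i) ξ))) atTop
          (𝓝 (α a ξ)) := hsum ξ a
        refine h.congr fun F => ?_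
        rw [sum_apply]
        rfl }
  refine ⟨n, V, ?_, hfinal⟩
  rw [Order.one_le_iff_ne_zero]
  rintro rfl
  have : IsEmpty (Idx 0) := ⟨fun i => not_lt_zero i.2⟩
  refine hα ?_
  ext a x
  exact (hsum x a).unique (by simp)

end

/-! ### The norm and non-degeneracy -/

section

variable {H : Type*} [NormedAddCommGroup H] [InnerProductSpace ℂ H] [CompleteSpace H]

section Nondegenerate

variable {α : (H →L[ℂ] H) →⋆ₙₐ[ℂ] (H →L[ℂ] H)} {L : (H →L[ℂ] H) →L[ℂ] (H →L[ℂ] H)} {t : ℝ}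

theorem map_map_one_eq_iff (hα : α ≠ 0) (hL1 : L 1 = (t : ℂ) • 1) : α (L 1) = α 1 ↔ t = 1 := by
  rw [hL1, map_smul]
  constructor
  · intro h
    have h1 : ((t : ℂ) - 1) • α 1 = 0 := by rw [sub_smul, h, one_smul, sub_self]
    have h2 := (smul_eq_zero.1 h1).resolve_right (map_one_ne_zero hα)
    exact_mod_cast sub_eq_zero.1 h2
  · rintro rfl
    simp

theorem IsTransferOperator.map_map (hL : IsTransferOperator α (L : (H →L[ℂ] H) →ₗ[ℂ] (H →L[ℂ] H)))
    (a : H →L[ℂ] H) : L (α a) = a * L 1 := by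
  simpa using hL.transfer a 1

theorem map_map_map_eq_iff (hα : α ≠ 0)
    (hL : IsTransferOperator α (L : (H →L[ℂ] H) →ₗ[ℂ] (H →L[ℂ] H))) (hL1 : L 1 = (t : ℂ) • 1) :
    (∀ a, α (L (α a)) = α a) ↔ t = 1 := by
  rw [← map_map_one_eq_iff hα hL1]
  refine ⟨fun h => by simpa [hL.map_map] using h 1, fun h a => ?_⟩
  rw [hL.map_map, map_mul, h, ← map_mul, mul_one]

theorem isNondegenerate_iff (hα : α ≠ 0)
    (hL : IsTransferOperator α (L : (H →L[ℂ] H) →ₗ[ℂ] (H →L[ℂ] H))) (hL1 : L 1 = (t : ℂ) • 1)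
    (hn : ‖L‖ = t) : IsNondegenerate α (L : (H →L[ℂ] H) →ₗ[ℂ] (H →L[ℂ] H)) ↔ t = 1 := by
  constructor
  · intro h
    exact (map_map_map_eq_iff hα hL hL1).1 fun a => h.apply_of_mem (α a) ⟨a, rfl⟩
  · intro ht
    have hfix := (map_map_map_eq_iff hα hL hL1).2 ht
    refine ⟨fun a => ⟨L a, rfl⟩, ?_, fun a => ?_, fun a ha => ?_, ?_, ?_⟩
    · rintro _ ⟨a, rfl⟩
      exact hfix a
    · calc ‖α (L a)‖ ≤ ‖L a‖ := NonUnitalStarAlgHom.norm_apply_le α _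
        _ ≤ ‖L‖ * ‖a‖ := L.le_opNorm a
        _ = ‖a‖ := by rw [hn, ht, one_mul]
    · exact map_nonneg α (hL.positive a ha)
    · rintro _ ⟨c, rfl⟩ a
      exact (congrArg α (hL.transfer c a)).trans (map_mul α _ _)
    · rintro _ ⟨c, rfl⟩ a
      exact (congrArg α (hL.map_mul_right c a)).trans (map_mul α _ _)

end Nondegenerate

/-- A positive trace class operator has a Kraus family whose map is the one and only linear map
given by the transfer form. -/
theorem exists_isKrausFamily_hasTransferForm {α : (H →L[ℂ] H) →⋆ₙₐ[ℂ] (H →L[ℂ] H)} {n : ℕ∞}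
    {U : Idx n → (H →L[ℂ] H)} [Nontrivial H] (hU : IsIsometryFamily α U) {ρ : Hn n →L[ℂ] Hn n}
    (hρ : IsPositiveTraceClass ρ) :
    ∃ (W : Idx n → (H →L[ℂ] H)) (hW : IsKrausFamily α W (trace ρ)),
      HasTransferForm U ρ (hW.map : (H →L[ℂ] H) →ₗ[ℂ] (H →L[ℂ] H)) ∧
      ∀ L : (H →L[ℂ] H) →ₗ[ℂ] (H →L[ℂ] H), HasTransferForm U ρ L → L = hW.map := by
  obtain ⟨W, hW, hlim⟩ := exists_isKrausFamily hU hρ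
  exact ⟨W, hW, fun a => weakTendsto_of_tendsto (hlim a), fun L hL =>
    LinearMap.ext fun a => (hL a).unique (weakTendsto_of_tendsto (hlim a))⟩

end

end TransferBH

theorem mainTheorem4 {H : Type*} [NormedAddCommGroup H] [InnerProductSpace ℂ H] [CompleteSpace H]
    [TopologicalSpace.SeparableSpace H]
    (α : (H →L[ℂ] H) →⋆ₙₐ[ℂ] (H →L[ℂ] H)) (hα : α ≠ 0) :
    (∃ (n : ℕ∞) (U : TransferBH.Idx n → (H →L[ℂ] H)), 1 ≤ n ∧ TransferBH.IsIsometryFamily α U) ∧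
    ∀ (n : ℕ∞) (U : TransferBH.Idx n → (H →L[ℂ] H)), TransferBH.IsIsometryFamily α U →
      -- the normal transfer operators are exactly the operators of the given form
      (∀ L : (H →L[ℂ] H) →ₗ[ℂ] (H →L[ℂ] H),
        (TransferBH.IsTransferOperator α L ∧ TransferBH.IsNormalMap L) ↔
          ∃ ρ : TransferBH.Hn n →L[ℂ] TransferBH.Hn n,
            TransferBH.IsPositiveTraceClass ρ ∧ TransferBH.HasTransferForm U ρ L) ∧
      -- every positive trace class operator gives such an operator
      (∀ ρ : TransferBH.Hn n →L[ℂ] TransferBH.Hn n, TransferBH.IsPositiveTraceClass ρ →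
        ∃ L : (H →L[ℂ] H) →L[ℂ] (H →L[ℂ] H), TransferBH.HasTransferForm U ρ L) ∧
      -- its norm and its non-degeneracy are read off from the trace
      (∀ (ρ : TransferBH.Hn n →L[ℂ] TransferBH.Hn n) (L : (H →L[ℂ] H) →L[ℂ] (H →L[ℂ] H)),
        TransferBH.IsPositiveTraceClass ρ → TransferBH.HasTransferForm U ρ L →
          ‖L‖ = TransferBH.trace ρ ∧
          (TransferBH.IsNondegenerate α L ↔ TransferBH.trace ρ = 1) ∧
          ((∀ a, α (L (α a)) = α a) ↔ TransferBH.trace ρ = 1) ∧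
          (α (L 1) = α 1 ↔ TransferBH.trace ρ = 1)) ∧
      -- the matrices of positive trace class operators
      (∀ r : TransferBH.Idx n → TransferBH.Idx n → ℂ,
        (∃ ρ : TransferBH.Hn n →L[ℂ] TransferBH.Hn n,
          TransferBH.IsPositiveTraceClass ρ ∧ ∀ i j, TransferBH.entry ρ i j = r i j) ↔
        ((∀ z : TransferBH.Idx n →₀ ℂ,
            0 ≤ ∑ i ∈ z.support, ∑ j ∈ z.support, r i j * z i * conj (z j)) ∧
          Summable fun i => (r i i).re)) := by
  have := TransferBH.nontrivial_of_ne_zero hα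
  refine ⟨TransferBH.exists_isIsometryFamily α hα, fun n U hU => ⟨fun L => ⟨?_, ?_⟩, ?_, ?_, ?_⟩⟩
  · rintro ⟨hL, hN⟩
    exact TransferBH.exists_of_isNormalMap hU hL hN
  · rintro ⟨ρ, hρ, hL⟩
    obtain ⟨W, hW, -, huniq⟩ := TransferBH.exists_isKrausFamily_hasTransferForm hU hρ
    rw [huniq L hL]
    exact ⟨hW.isTransferOperator, hW.isNormalMap⟩
  · intro ρ hρ
    obtain ⟨W, hW, hform, -⟩ := TransferBH.exists_isKrausFamily_hasTransferForm hU hρ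
    exact ⟨hW.map, hform⟩
  · intro ρ L hρ hL
    obtain ⟨W, hW, -, huniq⟩ := TransferBH.exists_isKrausFamily_hasTransferForm hU hρ
    obtain rfl : L = hW.map := ContinuousLinearMap.coe_injective (huniq L hL)
    exact ⟨hW.norm_map,
      TransferBH.isNondegenerate_iff hα hW.isTransferOperator hW.tsum_one hW.norm_map,
      TransferBH.map_map_map_eq_iff hα hW.isTransferOperator hW.tsum_one,
      TransferBH.map_map_one_eq_iff hα hW.tsum_one⟩
  · intro r
    constructor
    · rintro ⟨ρ, hρ, hr⟩
      obtain rfl : TransferBH.entry ρ = r := funext fun i => funext fun j => hr i j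
      exact ⟨fun z => TransferBH.sum_entry_nonneg hρ.1 _ _, hρ.2⟩
    · rintro ⟨hpos, hs⟩
      exact TransferBH.exists_isPositiveTraceClass
        (TransferBH.sum_nonneg_of_forall_finsupp hpos) hs
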